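/- Let $k\ge 2$ be an integer. A weakly increasing $k$-ary tree (with repetitions) is a nonempty $k$-ary plane tree, in which each node has $k$ child positions, each of which may be empty, whose nodes carry positive integer labels such that the labels are strictly increasing along every branch starting from the root, and the set of labels occurring in the tree is $\{1,2,\dots,m\}$ for some $m\ge 1$; the same label may occur several times, in distinct branches. The size of such a tree is the number of leaves of the completed tree, i.e. of the tree obtained by attaching an unlabeled leaf at each empty child position. For each $n$ there are only finitely many weakly increasing $k$-ary trees of size $n$; let $G_n$ be their number. Theorem. One has $G_n=0$ whenever $n\not\equiv 1 \pmod{k-1}$. Moreover, there is a constant $\eta_k>0$, depending only on $k$, such that $$G_{1+(k-1)m}\;\sim\;\eta_k\, m^{\frac{2-k\ln 2}{2(k-1)}}\left(\frac{k-1}{\ln 2}\right)^m (m-1)!\qquad\text{as } m\to\infty .$$ -/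

import Mathlib

/-- Completed `k`-ary plane trees whose internal nodes are labeled by natural numbers: `leaf` is an
unlabeled leaf of the completed tree (that is, an empty child position of the uncompleted tree), and
`node a c` is a node with label `a` and with (possibly empty) child `c i` in position `i`. -/
inductive KAryTree (k : ℕ) : Type where
  | leaf : KAryTree k
  | node (a : ℕ) (c : Fin k → KAryTree k) : KAryTree k

namespace KAryTree

/-- The size of a tree: the number of leaves of the completed tree. -/
def size {k : ℕ} : KAryTree k → ℕ
  | leaf => 1
  | node _ c => ∑ i, size (c i)

/-- The set of labels that occur in the tree. -/
def labels {k : ℕ} : KAryTree k → Finset ℕ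
  | leaf => ∅
  | node a c => insert a (Finset.univ.biUnion fun i => labels (c i))

/-- Along each branch, starting from the root, the labels are strictly increasing: the label of
each node is smaller than all labels occurring below it. -/
def StrictlyIncreasing {k : ℕ} : KAryTree k → Prop
  | leaf => True
  | node a c => ∀ i, (∀ b ∈ labels (c i), a < b) ∧ StrictlyIncreasing (c i)

/-- A weakly increasing `k`-ary tree (with repetitions): labels are strictly increasing along each
branch, and the set of labels is `{1, …, m}` for some `m ≥ 1`. The same label may occur several
times, in distinct branches. (As `m ≥ 1`, the tree has at least one labeled node.) -/
def IsWeaklyIncreasing {k : ℕ} (t : KAryTree k) : Prop :=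
  t.StrictlyIncreasing ∧ ∃ m : ℕ, 1 ≤ m ∧ t.labels = Finset.Icc 1 m

end KAryTree

/-- The set of weakly increasing `k`-ary trees of size `n`. -/
def weaklyIncreasingTrees (k n : ℕ) : Set (KAryTree k) :=
  {t | t.IsWeaklyIncreasing ∧ t.size = n}

/-- The number `G_n` of weakly increasing `k`-ary trees of size `n`. -/
noncomputable def numWeaklyIncreasingTrees (k n : ℕ) : ℕ :=
  (weaklyIncreasingTrees k n).ncard

/-! By `size_eq` the size is `1 + (k - 1) * nodes`, which gives the congruence, and it suffices to
count trees by their number of nodes. In an increasing tree with label set `{1, …, M}`, the nodes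
labeled `M` have only leaves as children. Cutting them off yields a smaller such tree, and
conversely one puts the next label on a nonempty set of leaves. With `q = k - 1` this gives `g m =
∑_{j<m} C(1 + q j, m - j) g j` (`numIncreasingTrees_rec`).

The binomial is `q^l / l!` times a product of `l` factors close to `j`. Dividing `g (n + 1)` by `(q
/ ln 2)^(n+1) ∏ (j + 1 + α)` gives a sequence `u` with `u (N+1) = ∑ v N i * u (N - i)`, whose
weights tend to `(ln 2)^l / l!` for `l = i + 1`. These limits sum to `e^{ln 2} - 1 = 1`. The
exponent `α` is the one for which the `1/m` correction to the total weight vanishes as well, so that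
the total is `1 + O(1/m²)`, a summable error (`abs_sum_weight_sub_one_le`).

Such a `u` stays between positive bounds. Its total variation is finite because the mean of `i`
under the limit weights is `2 ln 2 - 1 < 1`; hence `u` has a positive limit
(`exists_tendsto_of_averaging`). The Gamma function turns the product into `m^α (m - 1)!` up to a
constant. -/

namespace KAryTree

open Polynomial

variable {k : ℕ}

/-! ### Adding and removing the nodes of maximal label -/

/-- The number of internal (labeled) nodes of a tree. -/
def nodes : KAryTree k → ℕ
  | leaf => 0
  | node _ c => 1 + ∑ i, nodes (c i)

/-- Cut off all subtrees whose root is labeled `a`. -/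
def trim (a : ℕ) : KAryTree k → KAryTree k
  | leaf => leaf
  | node b c => if b = a then leaf else node b fun i => trim a (c i)

theorem node_injective (a : ℕ) : Function.Injective (node (k := k) a) :=
  fun _ _ h => (node.inj h).2

open Classical in
/-- All trees obtained by turning some of the leaves into nodes labeled `a` without children. -/
noncomputable def extensions (a : ℕ) : KAryTree k → Finset (KAryTree k)
  | leaf => {leaf, node a fun _ => leaf}
  | node b c => (Fintype.piFinset fun i => extensions a (c i)).map
      ⟨node b, node_injective b⟩

theorem size_eq (hk : 1 ≤ k) (t : KAryTree k) : t.size = 1 + (k - 1) * t.nodes := by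
  induction t with
  | leaf => simp [size, nodes]
  | node a c ih =>
    obtain ⟨q, rfl⟩ : ∃ q, k = q + 1 := ⟨k - 1, by omega⟩
    simp only [size, nodes, ih, Finset.sum_add_distrib, ← Finset.mul_sum]
    simp
    ring

theorem mem_extensions_leaf {a : ℕ} {s : KAryTree k} :
    s ∈ extensions a leaf ↔ s = leaf ∨ s = node a fun _ => leaf := by
  simp [extensions]

theorem mem_extensions_node {a b : ℕ} {c : Fin k → KAryTree k} {s : KAryTree k} :
    s ∈ extensions a (node b c) ↔ ∃ d, (∀ i, d i ∈ extensions a (c i)) ∧ s = node b d := by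
  simp [extensions, eq_comm]

/-- Each leaf independently stays (factor `1`) or becomes a node (factor `X`), and `size` counts the
leaves. -/
theorem sum_extensions (a : ℕ) (t : KAryTree k) :
    ∑ s ∈ extensions a t, (X : ℕ[X]) ^ s.nodes = X ^ t.nodes * (1 + X) ^ t.size := by
  classical
  induction t with
  | leaf =>
    rw [extensions, Finset.sum_pair (by simp)]
    simp [nodes, size]
  | node b c ih =>
    simp only [extensions, Finset.sum_map, Function.Embedding.coeFn_mk, nodes, size, pow_add,
      pow_one, ← Finset.mul_sum, ← Finset.prod_pow_eq_pow_sum]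
    rw [← Finset.prod_univ_sum (fun i => extensions a (c i)) fun _ s => X ^ s.nodes, mul_assoc, ← Finset.prod_mul_distrib]
    simp only [ih]

theorem card_extensions (a l : ℕ) (t : KAryTree k) :
    ((extensions a t).filter fun s => s.nodes = t.nodes + l).card = t.size.choose l := by
  have h := congrArg (fun p : ℕ[X] => p.coeff (t.nodes + l)) (sum_extensions a t)
  simp only [finsetSum_coeff, coeff_X_pow, coeff_X_pow_mul', add_tsub_cancel_left] at h
  rw [Finset.card_filter]
  simpa [eq_comm, coeff_one_add_X_pow] using h

theorem labels_eq_empty {t : KAryTree k} : t.labels = ∅ ↔ t = leaf := by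
  cases t <;> simp [labels]

theorem trim_of_notMem {a : ℕ} {t : KAryTree k} (h : a ∉ t.labels) : trim a t = t := by
  induction t with
  | leaf => rfl
  | node b c ih =>
    simp only [labels, Finset.mem_insert, Finset.mem_biUnion, Finset.mem_univ, true_and, not_or,
      not_exists] at h
    rw [trim, if_neg (Ne.symm h.1)]
    congr
    exact funext fun i => ih i (h.2 i)

theorem trim_of_mem_extensions {a : ℕ} {s t : KAryTree k} (h : s ∈ extensions a t)
    (ht : a ∉ t.labels) : trim a s = t := by
  induction t generalizing s with
  | leaf =>
    rcases mem_extensions_leaf.1 h with rfl | rfl <;> simp [trim]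
  | node b c ih =>
    obtain ⟨d, hd, rfl⟩ := mem_extensions_node.1 h
    simp only [labels, Finset.mem_insert, Finset.mem_biUnion, Finset.mem_univ, true_and, not_or,
      not_exists] at ht
    rw [trim, if_neg (Ne.symm ht.1)]
    congr
    exact funext fun i => ih i (hd i) (ht.2 i)

theorem mem_extensions_trim {a : ℕ} {s : KAryTree k} (hs : s.StrictlyIncreasing)
    (ha : ∀ b ∈ s.labels, b ≤ a) : s ∈ extensions a (trim a s) := by
  induction s with
  | leaf => simp [trim, extensions]
  | node b c ih =>
    simp only [labels, Finset.mem_insert, Finset.mem_biUnion, Finset.mem_univ, true_and] at ha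
    rw [trim]
    split_ifs with hb
    · subst hb
      refine mem_extensions_leaf.2 (Or.inr ?_)
      congr
      funext i
      refine labels_eq_empty.1 (Finset.eq_empty_of_forall_notMem fun x hx => ?_)
      exact absurd ((hs i).1 x hx) (not_lt.2 (ha x (Or.inr ⟨i, hx⟩)))
    · exact mem_extensions_node.2
        ⟨c, fun i => ih i (hs i).2 fun x hx => ha x (Or.inr ⟨i, hx⟩), rfl⟩

theorem labels_trim {a : ℕ} {s : KAryTree k} (hs : s.StrictlyIncreasing)
    (ha : ∀ b ∈ s.labels, b ≤ a) : (trim a s).labels = s.labels.erase a := by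
  induction s with
  | leaf => simp [trim, labels]
  | node b c ih =>
    simp only [labels, Finset.mem_insert, Finset.mem_biUnion, Finset.mem_univ, true_and] at ha
    have ih' := fun i => ih i (hs i).2 fun x hx => ha x (Or.inr ⟨i, hx⟩)
    rw [trim]
    split_ifs with hb
    · subst hb
      ext x
      simp only [labels, Finset.notMem_empty, Finset.mem_erase, Finset.mem_insert,
        Finset.mem_biUnion, Finset.mem_univ, true_and, false_iff, not_and, not_or, not_exists]
      exact fun hx => ⟨hx, fun i hi =>
        absurd ((hs i).1 x hi) (not_lt.2 (ha x (Or.inr ⟨i, hi⟩)))⟩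
    · ext x
      simp only [labels, ih', Finset.mem_insert, Finset.mem_biUnion, Finset.mem_univ, true_and,
        Finset.mem_erase]
      constructor
      · rintro (rfl | ⟨i, h1, h2⟩)
        · exact ⟨hb, Or.inl rfl⟩
        · exact ⟨h1, Or.inr ⟨i, h2⟩⟩
      · rintro ⟨h1, h2 | ⟨i, h2⟩⟩
        · exact Or.inl h2
        · exact Or.inr ⟨i, h1, h2⟩

theorem strictlyIncreasing_trim {a : ℕ} {s : KAryTree k} (hs : s.StrictlyIncreasing)
    (ha : ∀ b ∈ s.labels, b ≤ a) : (trim a s).StrictlyIncreasing := by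
  induction s with
  | leaf => trivial
  | node b c ih =>
    simp only [labels, Finset.mem_insert, Finset.mem_biUnion, Finset.mem_univ, true_and] at ha
    have ha' := fun i x (hx : x ∈ (c i).labels) => ha x (Or.inr ⟨i, hx⟩)
    rw [trim]
    split_ifs with hb
    · trivial
    · refine fun i => ⟨fun x hx => ?_, ih i (hs i).2 (ha' i)⟩
      rw [labels_trim (hs i).2 (ha' i)] at hx
      exact (hs i).1 x (Finset.mem_of_mem_erase hx)

theorem nodes_trim_lt {a : ℕ} {s : KAryTree k} (h : a ∈ s.labels) :
    (trim a s).nodes < s.nodes := by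
  -- The strict induction below needs the weak inequality for the siblings of the child containing
  -- `a`.
  have le (s : KAryTree k) : (trim a s).nodes ≤ s.nodes := by
    induction s with
    | leaf => rfl
    | node b c ih =>
      rw [trim]
      split_ifs
      · simp [nodes]
      · simp only [nodes]
        gcongr with i
        exact ih i
  induction s with
  | leaf => simp [labels] at h
  | node b c ih =>
    simp only [labels, Finset.mem_insert, Finset.mem_biUnion, Finset.mem_univ, true_and] at h
    rw [trim]
    split_ifs with hb
    · simp [nodes]
    · obtain rfl | ⟨i, hi⟩ := h
      · exact absurd rfl hb
      · simp only [nodes]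
        exact Nat.add_lt_add_left
          (Finset.sum_lt_sum (fun j _ => le (c j)) ⟨i, Finset.mem_univ i, ih i hi⟩) 1

theorem labels_subset_of_mem_extensions {a : ℕ} {s t : KAryTree k} (h : s ∈ extensions a t) :
    s.labels ⊆ insert a t.labels := by
  induction t generalizing s with
  | leaf => rcases mem_extensions_leaf.1 h with rfl | rfl <;> intro x <;> simp [labels]
  | node b c ih =>
    obtain ⟨d, hd, rfl⟩ := mem_extensions_node.1 h
    intro x
    simp only [labels, Finset.mem_insert, Finset.mem_biUnion, Finset.mem_univ, true_and]
    rintro (rfl | ⟨i, hi⟩)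
    · exact Or.inr (Or.inl rfl)
    · rcases Finset.mem_insert.1 (ih i (hd i) hi) with h | h
      · exact Or.inl h
      · exact Or.inr (Or.inr ⟨i, h⟩)

theorem strictlyIncreasing_of_mem_extensions {a : ℕ} {s t : KAryTree k} (h : s ∈ extensions a t)
    (ht : t.StrictlyIncreasing) (ha : ∀ b ∈ t.labels, b < a) : s.StrictlyIncreasing := by
  induction t generalizing s with
  | leaf =>
    rcases mem_extensions_leaf.1 h with rfl | rfl <;> simp [StrictlyIncreasing, labels]
  | node b c ih =>
    obtain ⟨d, hd, rfl⟩ := mem_extensions_node.1 h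
    simp only [labels, Finset.mem_insert, Finset.mem_biUnion, Finset.mem_univ, true_and] at ha
    refine fun i => ⟨fun x hx => ?_, ih i (hd i) (ht i).2 fun x hx => ha x (Or.inr ⟨i, hx⟩)⟩
    rcases Finset.mem_insert.1 (labels_subset_of_mem_extensions (hd i) hx) with rfl | h
    · exact ha b (Or.inl rfl)
    · exact (ht i).1 x h

theorem labels_of_mem_extensions {a : ℕ} {s t : KAryTree k} (h : s ∈ extensions a t)
    (ht : t.StrictlyIncreasing) (ha : ∀ b ∈ t.labels, b < a) (hne : s.nodes ≠ t.nodes) :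
    s.labels = insert a t.labels := by
  have hsub := labels_subset_of_mem_extensions h
  have hat : a ∉ t.labels := fun h => (ha a h).false
  have htrim := trim_of_mem_extensions h hat
  have has : a ∈ s.labels := by
    by_contra hn
    exact hne (by rw [← htrim, trim_of_notMem hn])
  have hle : ∀ b ∈ s.labels, b ≤ a := fun b hb => by
    rcases Finset.mem_insert.1 (hsub hb) with rfl | h
    · exact le_rfl
    · exact (ha b h).le
  rw [← htrim, labels_trim (strictlyIncreasing_of_mem_extensions h ht ha) hle,
    Finset.insert_erase has]

/-! ### The recurrence for the number of trees -/

/-- The weakly increasing `k`-ary trees with `m` nodes, together with the single leaf for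
`m = 0`. -/
def increasingTrees (k m : ℕ) : Set (KAryTree k) :=
  {t | (t.StrictlyIncreasing ∧ ∃ M, t.labels = Finset.Icc 1 M) ∧ t.nodes = m}

theorem increasingTrees_zero : increasingTrees k 0 = {leaf} := by
  ext t
  cases t with
  | leaf => simpa [increasingTrees, StrictlyIncreasing, labels, nodes] using ⟨0, by simp⟩
  | node a c => simp [increasingTrees, nodes]

theorem mem_increasingTrees_iff {m : ℕ} (hm : m ≠ 0) {s : KAryTree k} :
    s ∈ increasingTrees k m ↔ ∃ j < m, ∃ t ∈ increasingTrees k j,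
      s ∈ extensions (t.labels.card + 1) t ∧ s.nodes = m := by
  constructor
  · rintro ⟨⟨hs, M, hM⟩, hsm⟩
    obtain _ | M := M
    · rw [show Finset.Icc 1 0 = ∅ by simp, labels_eq_empty] at hM
      subst hM
      exact absurd hsm.symm hm
    have hle : ∀ b ∈ s.labels, b ≤ M + 1 := by
      rw [hM]
      exact fun b hb => (Finset.mem_Icc.1 hb).2
    have hlab : (trim (M + 1) s).labels = Finset.Icc 1 M := by
      rw [labels_trim hs hle, hM]
      ext x
      simp only [Finset.mem_erase, Finset.mem_Icc]
      omega
    refine ⟨_, hsm ▸ nodes_trim_lt (a := M + 1) (by simp [hM]), trim (M + 1) s,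
      ⟨⟨strictlyIncreasing_trim hs hle, M, hlab⟩, rfl⟩, ?_, hsm⟩
    rw [hlab]
    simpa using mem_extensions_trim hs hle
  · rintro ⟨j, hj, t, ⟨⟨ht, M, hM⟩, rfl⟩, hst, rfl⟩
    have hlt : ∀ b ∈ t.labels, b < t.labels.card + 1 := by
      rw [hM]
      intro b hb
      have := (Finset.mem_Icc.1 hb).2
      simp
      omega
    refine ⟨⟨strictlyIncreasing_of_mem_extensions hst ht hlt, M + 1, ?_⟩, rfl⟩
    rw [labels_of_mem_extensions hst ht hlt hj.ne', hM]
    ext x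
    simp only [Nat.card_Icc, Finset.mem_insert, Finset.mem_Icc]
    omega

/-- The largest label of `s` is its number of labels, so `s` alone determines `t`. This makes the
unions in the recurrence disjoint. -/
theorem card_labels_of_mem_extensions {s t : KAryTree k} {j : ℕ} (ht : t ∈ increasingTrees k j)
    (hst : s ∈ extensions (t.labels.card + 1) t) (hne : s.nodes ≠ j) :
    trim s.labels.card s = t := by
  obtain ⟨⟨ht, M, hM⟩, rfl⟩ := ht
  have hlt : ∀ b ∈ t.labels, b < t.labels.card + 1 := by
    rw [hM]
    intro b hb
    have := (Finset.mem_Icc.1 hb).2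
    simp
    omega
  have hn : t.labels.card + 1 ∉ t.labels := fun h => (hlt _ h).false
  rw [labels_of_mem_extensions hst ht hlt hne, Finset.card_insert_of_notMem hn]
  exact trim_of_mem_extensions hst hn

theorem increasingTrees_eq_biUnion {m : ℕ} (hm : m ≠ 0) :
    increasingTrees k m = ⋃ j ∈ Set.Iio m, ⋃ t ∈ increasingTrees k j,
      {s | s ∈ extensions (t.labels.card + 1) t ∧ s.nodes = m} := by
  ext s
  simp only [mem_increasingTrees_iff hm, Set.mem_iUnion, Set.mem_Iio, Set.mem_ofPred_eq, exists_prop]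

theorem finite_increasingTrees (k m : ℕ) : (increasingTrees k m).Finite := by
  induction m using Nat.strong_induction_on with
  | _ m ih =>
    rcases eq_or_ne m 0 with rfl | hm
    · simp [increasingTrees_zero]
    · rw [increasingTrees_eq_biUnion hm]
      exact (Set.finite_Iio m).biUnion fun j hj => (ih j hj).biUnion fun t _ =>
        (extensions (t.labels.card + 1) t).finite_toSet.subset fun s hs => hs.1

/-- The number of weakly increasing `k`-ary trees with `m` nodes (one for `m = 0`). -/
noncomputable def numIncreasingTrees (k m : ℕ) : ℕ := (increasingTrees k m).ncard

theorem numIncreasingTrees_zero : numIncreasingTrees k 0 = 1 := by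
  simp [numIncreasingTrees, increasingTrees_zero]

theorem numIncreasingTrees_rec (hk : 1 ≤ k) {m : ℕ} (hm : m ≠ 0) :
    numIncreasingTrees k m = ∑ j ∈ Finset.range m,
      (1 + (k - 1) * j).choose (m - j) * numIncreasingTrees k j := by
  classical
  let T (j : ℕ) : Finset (KAryTree k) := (finite_increasingTrees k j).toFinset
  have hT {j : ℕ} {t : KAryTree k} : t ∈ T j ↔ t ∈ increasingTrees k j := by simp [T]
  have hcard (j : ℕ) : numIncreasingTrees k j = (T j).card :=
    Set.ncard_eq_toFinset_card _ _
  let E (t : KAryTree k) : Finset (KAryTree k) :=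
    (extensions (t.labels.card + 1) t).filter fun s => s.nodes = m
  have key : T m = (Finset.range m).biUnion fun j => (T j).biUnion E := by
    ext s
    rw [hT, mem_increasingTrees_iff hm]
    simp [E, hT]
  have hE {j : ℕ} (hj : j < m) {s t : KAryTree k} (ht : t ∈ T j) (hs : s ∈ E t) :
      trim s.labels.card s = t := by
    rw [Finset.mem_filter] at hs
    exact card_labels_of_mem_extensions (hT.1 ht) hs.1 (by omega)
  rw [hcard, key, Finset.card_biUnion]
  · refine Finset.sum_congr rfl fun j hj => ?_
    rw [Finset.mem_range] at hj
    rw [Finset.card_biUnion, hcard, mul_comm, ← smul_eq_mul, ← Finset.sum_const]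
    · refine Finset.sum_congr rfl fun t ht => ?_
      have hn : t.nodes = j := (hT.1 ht).2
      rw [← hn, ← size_eq hk, ← card_extensions (t.labels.card + 1), hn,
        Nat.add_sub_cancel' hj.le]
    · intro t ht t' ht' hne
      refine Finset.disjoint_left.2 fun s hs hs' => hne ?_
      rw [← hE hj ht hs, hE hj ht' hs']
  · intro j hj j' hj' hne
    refine Finset.disjoint_left.2 fun s hs hs' => hne ?_
    obtain ⟨t, ht, hs⟩ := Finset.mem_biUnion.1 hs
    obtain ⟨t', ht', hs'⟩ := Finset.mem_biUnion.1 hs'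
    have : t = t' := by
      rw [← hE (Finset.mem_range.1 hj) ht hs, hE (Finset.mem_range.1 hj') ht' hs']
    subst this
    exact (hT.1 ht).2.symm.trans (hT.1 ht').2

theorem weaklyIncreasingTrees_eq (hk : 2 ≤ k) {m : ℕ} (hm : m ≠ 0) :
    weaklyIncreasingTrees k (1 + (k - 1) * m) = increasingTrees k m := by
  have hsize (t : KAryTree k) : t.size = 1 + (k - 1) * m ↔ t.nodes = m := by
    rw [size_eq (by omega), Nat.add_left_cancel_iff]
    exact Nat.mul_right_inj (by omega)
  ext t
  constructor
  · rintro ⟨⟨h1, M, -, h2⟩, h3⟩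
    exact ⟨⟨h1, M, h2⟩, (hsize t).1 h3⟩
  · rintro ⟨⟨h1, M, h2⟩, h3⟩
    refine ⟨⟨h1, M, ?_, h2⟩, (hsize t).2 h3⟩
    by_contra hM
    obtain rfl : M = 0 := by omega
    rw [show Finset.Icc 1 0 = ∅ by simp, labels_eq_empty] at h2
    subst h2
    exact hm h3.symm

/-- Since `Set.ncard` is `0` on infinite sets, finiteness is what makes the count meaningful. -/
theorem finite_weaklyIncreasingTrees (hk : 2 ≤ k) (n : ℕ) :
    (weaklyIncreasingTrees k n).Finite := by
  rcases (weaklyIncreasingTrees k n).eq_empty_or_nonempty with h | ⟨t, -, ht⟩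
  · simp [h]
  · refine (finite_increasingTrees k t.nodes).subset ?_
    rintro s ⟨⟨h1, M, -, h2⟩, h3⟩
    refine ⟨⟨h1, M, h2⟩, ?_⟩
    rw [← ht, size_eq (by omega), size_eq (by omega), Nat.add_left_cancel_iff] at h3
    exact Nat.eq_of_mul_eq_mul_left (by omega) h3

theorem numWeaklyIncreasingTrees_eq_zero (hk : 2 ≤ k) {n : ℕ} (hn : ¬ n ≡ 1 [MOD (k - 1)]) :
    numWeaklyIncreasingTrees k n = 0 := by
  rw [numWeaklyIncreasingTrees, Set.ncard_eq_zero (finite_weaklyIncreasingTrees hk n),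
    Set.eq_empty_iff_forall_notMem]
  rintro t ⟨-, ht⟩
  apply hn
  rw [← ht, size_eq (by omega)]
  simp [Nat.ModEq]

end KAryTree

/-! ### Convergence of sequences that average their past -/

section Asymptotics

open Filter Topology Finset

/-- By truncated subtraction the terms with `m ≤ j` are `D 0 = 0`; the others form a shorter initial
segment. -/
theorem sum_range_tsub_le {D : ℕ → ℝ} (hD : ∀ n, 0 ≤ D n) (h0 : D 0 = 0) (N j : ℕ) :
    ∑ m ∈ range N, D (m - j) ≤ ∑ m ∈ range N, D m := by
  rcases le_total N j with h | h
  · rw [sum_eq_zero fun m hm => ?_]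
    · exact sum_nonneg fun m _ => hD m
    · rw [Nat.sub_eq_zero_of_le (by have := mem_range.1 hm; omega), h0]
  · obtain ⟨K, rfl⟩ := Nat.exists_eq_add_of_le h
    rw [sum_range_add, sum_eq_zero fun m hm => ?_, zero_add]
    · simp only [Nat.add_sub_cancel_left]
      exact sum_le_sum_of_subset_of_nonneg (range_subset_range.2 (by omega)) fun i _ _ => hD i
    · rw [Nat.sub_eq_zero_of_le (mem_range.1 hm).le, h0]

theorem abs_sub_tsub_le (u : ℕ → ℝ) (N i : ℕ) :
    |u (N - i) - u N| ≤ ∑ j ∈ range i, |u (N - j) - u (N - j - 1)| := by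
  induction i with
  | zero => simp
  | succ i ih =>
    rw [sum_range_succ, Nat.sub_sub]
    have := abs_sub_le (u (N - (i + 1))) (u (N - i)) (u N)
    rw [abs_sub_comm (u (N - (i + 1))) (u (N - i))] at this
    linarith

section Averaging

variable {u : ℕ → ℝ} {v : ℕ → ℕ → ℝ} {p ε : ℕ → ℝ}

/-- A positive sequence whose terms are averages of all earlier terms, up to a summable relative
error, is bounded. -/
theorem exists_le_of_averaging (hu : ∀ n, 0 < u n)
    (hrec : ∀ N, u (N + 1) = ∑ i ∈ range (N + 1), v N i * u (N - i))
    (hv : ∀ N i, 0 ≤ v N i) (hε : Summable ε)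
    (hsum : ∀ N, |∑ i ∈ range (N + 1), v N i - 1| ≤ ε N) : ∃ C, ∀ n, u n ≤ C := by
  have hε0 (N : ℕ) : 0 ≤ ε N := (abs_nonneg _).trans (hsum N)
  have key (n : ℕ) : u n ≤ u 0 * Real.exp (∑ i ∈ range n, ε i) := by
    induction n using Nat.strong_induction_on with
    | _ n ih =>
      obtain _ | N := n
      · simp
      set C := u 0 * Real.exp (∑ i ∈ range N, ε i) with hC
      have hC0 : 0 < C := mul_pos (hu 0) (Real.exp_pos _)
      calc u (N + 1) = ∑ i ∈ range (N + 1), v N i * u (N - i) := hrec N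
        _ ≤ ∑ i ∈ range (N + 1), v N i * C := by
          refine sum_le_sum fun i _ => mul_le_mul_of_nonneg_left ?_ (hv N i)
          refine (ih _ (by omega)).trans (mul_le_mul_of_nonneg_left ?_ (hu 0).le)
          exact Real.exp_le_exp.2 (sum_le_sum_of_subset_of_nonneg
            (range_subset_range.2 (by omega)) fun i _ _ => hε0 i)
        _ = (∑ i ∈ range (N + 1), v N i) * C := (sum_mul _ _ _).symm
        _ ≤ Real.exp (ε N) * C := by
          refine mul_le_mul_of_nonneg_right ?_ hC0.le
          have := (abs_le.1 (hsum N)).2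
          linarith [Real.add_one_le_exp (ε N)]
        _ = _ := by rw [hC, sum_range_succ, Real.exp_add]; ring
  refine ⟨u 0 * Real.exp (∑' i, ε i), fun n => (key n).trans ?_⟩
  exact mul_le_mul_of_nonneg_left (Real.exp_le_exp.2 (hε.sum_le_tsum _ fun i _ => hε0 i)) (hu 0).le

/-- A positive sequence whose terms are averages of all earlier terms, up to a summable relative
error, is bounded away from zero. -/
theorem exists_pos_le_of_averaging (hu : ∀ n, 0 < u n)
    (hrec : ∀ N, u (N + 1) = ∑ i ∈ range (N + 1), v N i * u (N - i))
    (hv : ∀ N i, 0 ≤ v N i) (hε : Summable ε)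
    (hsum : ∀ N, |∑ i ∈ range (N + 1), v N i - 1| ≤ ε N) : ∃ c > 0, ∀ n, c ≤ u n := by
  have hε0 (N : ℕ) : 0 ≤ ε N := (abs_nonneg _).trans (hsum N)
  -- Beyond `m` the errors lose at most half of the minimum of `u 0, …, u m`.
  obtain ⟨m, hm⟩ : ∃ m, ∑' i, ε (i + m) ≤ 1 / 2 :=
    ((tendsto_sum_nat_add ε).eventually (eventually_le_nhds (by norm_num))).exists
  have htail (n : ℕ) : ∑ i ∈ range n, ε (i + m) ≤ 1 / 2 :=
    (((summable_nat_add_iff m).2 hε).sum_le_tsum _ fun i _ => hε0 _).trans hm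
  obtain ⟨a, -, ha⟩ := exists_min_image (range (m + 1)) u ⟨0, by simp⟩
  have key (n : ℕ) : u a * (1 - ∑ i ∈ range (n - m), ε (i + m)) ≤ u n := by
    induction n using Nat.strong_induction_on with
    | _ n ih =>
      rcases le_or_gt n m with h | h
      · simpa [Nat.sub_eq_zero_of_le h] using ha n (by simp; omega)
      obtain ⟨K, rfl⟩ : ∃ K, n = m + K + 1 := ⟨n - m - 1, by omega⟩
      rw [show m + K + 1 - m = K + 1 by omega, sum_range_succ, hrec]
      set c := u a * (1 - ∑ i ∈ range K, ε (i + m)) with hc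
      have hle : c ≤ u a := by
        have := sum_nonneg fun i (_ : i ∈ range K) => hε0 (i + m)
        nlinarith [hu a]
      have hc0 : 0 ≤ c := mul_nonneg (hu a).le (by linarith [htail K])
      calc u a * (1 - (∑ i ∈ range K, ε (i + m) + ε (K + m))) = c - u a * ε (K + m) := by
            rw [hc]; ring
        _ ≤ (1 - ε (m + K)) * c := by
          rw [add_comm K m]
          nlinarith [hε0 (m + K)]
        _ ≤ (∑ i ∈ range (m + K + 1), v (m + K) i) * c := by
          refine mul_le_mul_of_nonneg_right ?_ hc0
          linarith [(abs_le.1 (hsum (m + K))).1]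
        _ = ∑ i ∈ range (m + K + 1), v (m + K) i * c := sum_mul _ _ _
        _ ≤ _ := by
          refine sum_le_sum fun i _ => mul_le_mul_of_nonneg_left ?_ (hv _ i)
          refine le_trans (mul_le_mul_of_nonneg_left ?_ (hu a).le) (ih _ (by omega))
          exact sub_le_sub_left (sum_le_sum_of_subset_of_nonneg
            (range_subset_range.2 (by omega)) fun i _ _ => hε0 _) _
  refine ⟨u a / 2, half_pos (hu a), fun n => le_trans ?_ (key n)⟩
  nlinarith [htail (n - m), hu a]

/-- A positive sequence whose terms are averages of all earlier terms, up to a summable relative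
error, with averaging weights whose mean delay is uniformly less than two, has a positive limit. -/
theorem exists_tendsto_of_averaging (hu : ∀ n, 0 < u n)
    (hrec : ∀ N, u (N + 1) = ∑ i ∈ range (N + 1), v N i * u (N - i))
    (hv : ∀ N i, 0 ≤ v N i) (hε : Summable ε)
    (hsum : ∀ N, |∑ i ∈ range (N + 1), v N i - 1| ≤ ε N)
    (hp : ∀ i, 0 ≤ p i) (hvp : ∀ N, ∀ i ≤ N, i ≠ 0 → v N i ≤ p i) {ρ : ℝ} (hρ : ρ < 1)
    (hpρ : ∀ n, ∑ i ∈ range n, i * p i ≤ ρ) : ∃ L > 0, Tendsto u atTop (𝓝 L) := by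
  obtain ⟨C, hC⟩ := exists_le_of_averaging hu hrec hv hε hsum
  obtain ⟨c, hc, hcu⟩ := exists_pos_le_of_averaging hu hrec hv hε hsum
  have hε0 (N : ℕ) : 0 ≤ ε N := (abs_nonneg _).trans (hsum N)
  set D : ℕ → ℝ := fun n => |u n - u (n - 1)| with hDdef
  have hD (n : ℕ) : 0 ≤ D n := abs_nonneg _
  have hD0 : D 0 = 0 := by simp [hDdef]
  have step (N : ℕ) :
      D (N + 1) ≤ ∑ i ∈ range (N + 1), p i * ∑ j ∈ range i, D (N - j) + ε N * C := by
    -- The term `i = 0` drops out of the first sum, so only weights with `i ≠ 0` need the bound `p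
    -- i`.
    have e : u (N + 1) - u N = ∑ i ∈ range (N + 1), v N i * (u (N - i) - u N) +
        (∑ i ∈ range (N + 1), v N i - 1) * u N := by
      simp only [mul_sub, sum_sub_distrib, ← sum_mul, ← hrec]
      ring
    change |u (N + 1) - u N| ≤ _
    rw [e]
    refine (abs_add_le _ _).trans (add_le_add ?_ ?_)
    · refine (abs_sum_le_sum_abs _ _).trans (sum_le_sum fun i hi => ?_)
      rw [abs_mul, abs_of_nonneg (hv N i)]
      rcases eq_or_ne i 0 with rfl | h
      · simp
      · exact mul_le_mul (hvp N i (by have := mem_range.1 hi; omega) h) (abs_sub_tsub_le u N i)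
          (abs_nonneg _) (hp i)
    · rw [abs_mul, abs_of_pos (hu N)]
      exact mul_le_mul (hsum N) (hC N) (hu N).le (hε0 N)
  -- Summing `step` over `N` and exchanging sums gives `S ≤ ρ * S + C * ∑' i, ε i`, which is solved
  -- for `S`.
  have bound (K : ℕ) : ∑ n ∈ range (K + 1), D n ≤ C * (∑' i, ε i) / (1 - ρ) := by
    set S := ∑ n ∈ range (K + 1), D n with hS
    have hS0 : 0 ≤ S := sum_nonneg fun n _ => hD n
    have hSK : ∑ n ∈ range K, D n ≤ S := by
      rw [hS, sum_range_succ]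
      linarith [hD K]
    have h1 : S ≤ ∑ N ∈ range K, (∑ i ∈ range K, p i * ∑ j ∈ range i, D (N - j) + ε N * C) := by
      rw [hS, sum_range_succ', hD0, add_zero]
      refine sum_le_sum fun N hN => (step N).trans (add_le_add_left ?_ _)
      exact sum_le_sum_of_subset_of_nonneg
        (range_subset_range.2 (by have := mem_range.1 hN; omega))
        fun i _ _ => mul_nonneg (hp i) (sum_nonneg fun j _ => hD _)
    have h2 : ∑ N ∈ range K, ∑ i ∈ range K, p i * ∑ j ∈ range i, D (N - j) ≤ ρ * S := by
      rw [sum_comm]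
      calc ∑ i ∈ range K, ∑ N ∈ range K, p i * ∑ j ∈ range i, D (N - j)
          ≤ ∑ i ∈ range K, i * p i * S := by
            refine sum_le_sum fun i _ => ?_
            rw [← mul_sum, sum_comm, mul_comm (i : ℝ), mul_assoc]
            refine mul_le_mul_of_nonneg_left ?_ (hp i)
            refine (sum_le_card_nsmul _ _ S fun j _ =>
              (sum_range_tsub_le hD hD0 K j).trans hSK).trans ?_
            simp
        _ = (∑ i ∈ range K, i * p i) * S := (sum_mul _ _ _).symm
        _ ≤ ρ * S := mul_le_mul_of_nonneg_right (hpρ K) hS0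
    have h3 : ∑ N ∈ range K, ε N * C ≤ C * ∑' i, ε i := by
      rw [← sum_mul, mul_comm]
      exact mul_le_mul_of_nonneg_left (hε.sum_le_tsum _ fun i _ => hε0 i)
        ((hu 0).le.trans (hC 0))
    rw [sum_add_distrib] at h1
    rw [le_div_iff₀ (by linarith)]
    linarith
  have hsumm : Summable D := summable_of_sum_range_le hD fun n =>
    (sum_le_sum_of_subset_of_nonneg (range_subset_range.2 n.le_succ) fun i _ _ => hD i).trans
      (bound n)
  have hcau : CauchySeq u := by
    refine cauchySeq_of_summable_dist ?_
    refine ((summable_nat_add_iff 1).2 hsumm).congr fun n => ?_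
    rw [dist_comm, Real.dist_eq]
    rfl
  obtain ⟨L, hL⟩ := cauchySeq_tendsto_of_complete hcau
  exact ⟨L, hc.trans_le (ge_of_tendsto' hL hcu), hL⟩

end Averaging

/-! ### First-order expansion and uniform bounds for the exact weights -/

/-- A product of factors close to `1`, to first order. -/
theorem abs_prod_one_add_sub_le {n : ℕ} {δ : ℕ → ℝ} {s : ℝ} (hs : s ≤ 1)
    (hδ : ∑ i ∈ range n, |δ i| ≤ s) :
    |∏ i ∈ range n, (1 + δ i) - 1 - ∑ i ∈ range n, δ i| ≤ 2 * s ^ 2 := by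
  -- This crude bound controls the cross term `(∏ - 1) * δ j` in the induction for `hsecond`.
  have hfirst (j : ℕ) (hj : j ≤ n) : |∏ i ∈ range j, (1 + δ i) - 1| ≤ 2 * s := by
    have h0 : 0 ≤ ∑ i ∈ range j, |δ i| := sum_nonneg fun i _ => abs_nonneg _
    have hjs : ∑ i ∈ range j, |δ i| ≤ s := (sum_le_sum_of_subset_of_nonneg
      (range_subset_range.2 hj) fun i _ _ => abs_nonneg _).trans hδ
    have h1 := norm_prod_one_add_sub_one_le (range j) δ
    simp only [Real.norm_eq_abs] at h1
    have h2 := Real.abs_exp_sub_one_le (x := ∑ i ∈ range j, |δ i|)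
      (by rw [abs_of_nonneg h0]; linarith)
    rw [abs_of_nonneg h0] at h2
    linarith [le_abs_self (Real.exp (∑ i ∈ range j, |δ i|) - 1)]
  have hsecond (j : ℕ) (hj : j ≤ n) :
      |∏ i ∈ range j, (1 + δ i) - 1 - ∑ i ∈ range j, δ i| ≤ 2 * s * ∑ i ∈ range j, |δ i| := by
    induction j with
    | zero => simp
    | succ j ih =>
      rw [prod_range_succ, sum_range_succ, sum_range_succ]
      have e : (∏ i ∈ range j, (1 + δ i)) * (1 + δ j) - 1 - (∑ i ∈ range j, δ i + δ j) =
          (∏ i ∈ range j, (1 + δ i) - 1 - ∑ i ∈ range j, δ i) +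
          (∏ i ∈ range j, (1 + δ i) - 1) * δ j := by ring
      rw [e]
      refine (abs_add_le _ _).trans ?_
      rw [abs_mul]
      have := mul_le_mul_of_nonneg_right (hfirst j (by omega)) (abs_nonneg (δ j))
      linarith [ih (by omega)]
  have h0 : 0 ≤ s := (sum_nonneg fun i _ => abs_nonneg _).trans hδ
  refine (hsecond n le_rfl).trans ?_
  nlinarith

/-- The exponent `α` in the growth rate, in terms of `y = 1 / (k - 1)`. -/
noncomputable def growthExponent (y : ℝ) : ℝ := y - (1 + y) * Real.log 2 / 2

/-- The ratio of the exact averaging weights to their limits. -/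
noncomputable def weightRatio (y x : ℝ) (l : ℕ) : ℝ :=
  ∏ t ∈ range l, (x + (1 - t) * y) / (x + t + growthExponent y)

/-- The first-order coefficient of `weightRatio y (m - l) l` in `1 / m`. -/
noncomputable def weightCoeff (y : ℝ) (l : ℕ) : ℝ :=
  (1 + y) / 2 * (l * Real.log 2 - l * (l - 1))

/-- The limiting averaging weights. -/
noncomputable def limitWeight (l : ℕ) : ℝ := Real.log 2 ^ l / l.factorial

section WeightRatio

variable {y : ℝ}

theorem growthExponent_gt (h0 : 0 ≤ y) : -(1 / 2) < growthExponent y := by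
  have := Real.log_two_lt_d9
  rw [growthExponent]
  nlinarith

theorem growthExponent_lt (h1 : y ≤ 1) : growthExponent y < 1 / 2 := by
  have := Real.log_two_gt_d9
  have := Real.log_two_lt_d9
  rw [growthExponent]
  nlinarith

theorem sum_weightCoeff (y : ℝ) (l : ℕ) :
    ∑ t ∈ range l, ((1 + y) * Real.log 2 / 2 - (1 + y) * t) = weightCoeff y l := by
  induction l with
  | zero => simp [weightCoeff]
  | succ l ih =>
    rw [sum_range_succ, ih, weightCoeff, weightCoeff]
    push_cast
    ring

theorem abs_weightRatio_sub_le (h0 : 0 ≤ y) (h1 : y ≤ 1) {l : ℕ} (hl : 1 ≤ l) {m : ℝ}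
    (hm : 8 * (l : ℝ) ^ 2 ≤ m) :
    |weightRatio y (m - l) l - 1 - weightCoeff y l / m| ≤ 40 * ((l : ℝ) ^ 2 / m) ^ 2 := by
  have hl' : (1 : ℝ) ≤ l := by exact_mod_cast hl
  have hll : (l : ℝ) ≤ l ^ 2 := by nlinarith
  have hm0 : 0 < m := by nlinarith
  have hα := growthExponent_gt h0
  have hα' := growthExponent_lt h1
  have hL := Real.log_two_gt_d9
  have hL' := Real.log_two_lt_d9
  -- `E t` is numerator minus denominator in the `t`-th factor of the ratio, and `D t` is the
  -- denominator.
  set E : ℕ → ℝ := fun t => (1 + y) * Real.log 2 / 2 - (1 + y) * t with hE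
  set D : ℕ → ℝ := fun t => m - l + t + growthExponent y with hD
  have hED (t : ℕ) (ht : t ∈ range l) : |E t| ≤ 2 * l ∧ m / 2 ≤ D t ∧ |m - D t| ≤ 2 * l := by
    have htl : (t : ℝ) + 1 ≤ l := by exact_mod_cast mem_range.1 ht
    have ht0 : (0 : ℝ) ≤ t := t.cast_nonneg
    refine ⟨abs_le.2 ⟨?_, ?_⟩, ?_, abs_le.2 ⟨?_, ?_⟩⟩ <;> simp only [hE, hD]
    · nlinarith
    · nlinarith
    · linarith
    · linarith
    · linarith
  have hprod : weightRatio y (m - l) l = ∏ t ∈ range l, (1 + E t / D t) := by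
    refine prod_congr rfl fun t ht => ?_
    have hDt : D t ≠ 0 := by
      have := (hED t ht).2.1
      intro h
      linarith
    change _ / D t = _
    rw [eq_comm, one_add_div hDt]
    congr 1
    simp only [hE, hD, growthExponent]
    ring
  have hr : (l : ℝ) ^ 2 / m ≤ 1 / 8 := by
    rw [div_le_iff₀ hm0]
    linarith
  have hs : ∑ t ∈ range l, |E t / D t| ≤ 4 * ((l : ℝ) ^ 2 / m) := by
    have (t : ℕ) (ht : t ∈ range l) : |E t / D t| ≤ 4 * l / m := by
      obtain ⟨h2, h3, -⟩ := hED t ht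
      rw [abs_div, abs_of_pos (a := D t) (by linarith)]
      calc |E t| / D t ≤ 2 * l / (m / 2) := by gcongr
        _ = 4 * l / m := by field_simp; norm_num
    refine (sum_le_card_nsmul _ _ _ this).trans_eq ?_
    rw [card_range, nsmul_eq_mul]
    ring
  have hfirst : |∑ t ∈ range l, E t / D t - weightCoeff y l / m| ≤ 8 * ((l : ℝ) ^ 2 / m) ^ 2 := by
    rw [← sum_weightCoeff, sum_div, ← sum_sub_distrib]
    have (t : ℕ) (ht : t ∈ range l) : |E t / D t - E t / m| ≤ 8 * (l : ℝ) ^ 2 / m ^ 2 := by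
      obtain ⟨h2, h3, h4⟩ := hED t ht
      have hDt : 0 < D t := by linarith
      have e : E t / D t - E t / m = E t * (m - D t) / (D t * m) := by
        field_simp
      rw [e, abs_div, abs_mul, abs_of_pos (mul_pos hDt hm0)]
      calc |E t| * |m - D t| / (D t * m) ≤ (2 * l) * (2 * l) / ((m / 2) * m) := by gcongr
        _ = _ := by field_simp; norm_num
    refine (abs_sum_le_sum_abs _ _).trans ((sum_le_card_nsmul _ _ _ this).trans ?_)
    rw [card_range, nsmul_eq_mul]
    calc (l : ℝ) * (8 * l ^ 2 / m ^ 2) ≤ l ^ 2 * (8 * l ^ 2 / m ^ 2) := by gcongr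
      _ = _ := by ring
  -- With `s = 4 l² / m` this costs `32 (l² / m)²`; adding the `8` of `hfirst` gives `40`.
  have hsecond := abs_prod_one_add_sub_le (by linarith) hs
  rw [← hprod] at hsecond
  have e : weightRatio y (m - l) l - 1 - weightCoeff y l / m =
      (weightRatio y (m - l) l - 1 - ∑ t ∈ range l, E t / D t) +
      (∑ t ∈ range l, E t / D t - weightCoeff y l / m) := by ring
  rw [e]
  refine (abs_add_le _ _).trans ?_
  nlinarith

theorem abs_weightCoeff_le (h0 : 0 ≤ y) (h1 : y ≤ 1) (l : ℕ) :
    |weightCoeff y l| ≤ (l : ℝ) ^ 2 := by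
  have hL := Real.log_two_gt_d9
  have hL' := Real.log_two_lt_d9
  rcases Nat.eq_zero_or_pos l with rfl | hl
  · simp [weightCoeff]
  have hl' : (1 : ℝ) ≤ l := by exact_mod_cast hl
  rw [weightCoeff, abs_mul, abs_of_nonneg (by linarith)]
  have h : |(l : ℝ) * Real.log 2 - l * (l - 1)| ≤ l ^ 2 := by
    rw [abs_le]
    constructor <;> nlinarith
  calc (1 + y) / 2 * |(l : ℝ) * Real.log 2 - l * (l - 1)| ≤ 1 * l ^ 2 := by
        gcongr
        linarith
    _ = _ := one_mul _

end WeightRatio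

section Choose

variable {q : ℕ}

theorem cast_choose_eq_prod (hq : q ≠ 0) (x l : ℕ) :
    ((1 + q * x).choose l : ℝ) =
      q ^ l / l.factorial * ∏ t ∈ range l, (x + (1 - t) * (q : ℝ)⁻¹) := by
  have hq' : (q : ℝ) ≠ 0 := by exact_mod_cast hq
  have hl : (l.factorial : ℝ) ≠ 0 := by exact_mod_cast l.factorial_ne_zero
  have h : (((1 + q * x).descFactorial l : ℕ) : ℝ) = l.factorial * (1 + q * x).choose l := by
    exact_mod_cast Nat.descFactorial_eq_factorial_mul_choose _ _
  rw [← descPochhammer_eval_eq_descFactorial, descPochhammer_eval_eq_prod_range] at h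
  have e : ∏ t ∈ range l, (((1 + q * x : ℕ) : ℝ) - t) =
      q ^ l * ∏ t ∈ range l, (x + (1 - t) * (q : ℝ)⁻¹) := by
    rw [← card_range l, ← prod_const, card_range, ← prod_mul_distrib]
    refine prod_congr rfl fun t _ => ?_
    push_cast
    field_simp
    ring
  rw [e] at h
  rw [div_mul_eq_mul_div, eq_div_iff hl, h, mul_comm]

theorem growthExponent_pos_of_one_le {y x : ℝ} (h0 : 0 ≤ y) (hx : 1 ≤ x) {t : ℝ} (ht : 0 ≤ t) :
    0 < x + t + growthExponent y := by
  linarith [growthExponent_gt h0]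

/-- Single factors may be negative, but the numerator is a positive multiple of a binomial
coefficient. -/
theorem weightRatio_nonneg (hq : q ≠ 0) {x : ℕ} (hx : 1 ≤ x) (l : ℕ) :
    0 ≤ weightRatio (q : ℝ)⁻¹ x l := by
  have hx' : (1 : ℝ) ≤ x := by exact_mod_cast hx
  rw [weightRatio, prod_div_distrib]
  refine div_nonneg ?_ (prod_nonneg fun t _ =>
    (growthExponent_pos_of_one_le (by positivity) hx' t.cast_nonneg).le)
  have h := cast_choose_eq_prod hq x l
  have h0 : (0 : ℝ) < (q : ℝ) ^ l / l.factorial := by positivity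
  by_contra hneg
  have := mul_neg_of_pos_of_neg h0 (not_le.1 hneg)
  rw [← h] at this
  exact absurd this (not_lt.2 (Nat.cast_nonneg _))

/-- The factor `t = 0` exceeds `1`, which is why `l = 1` is excluded; its product with the factor `t
= 1` does not, nor do the later factors. -/
theorem weightRatio_le_one (hq : q ≠ 0) {x : ℕ} (hx : 1 ≤ x) {l : ℕ} (hl : 2 ≤ l) :
    weightRatio (q : ℝ)⁻¹ x l ≤ 1 := by
  have hx' : (1 : ℝ) ≤ x := by exact_mod_cast hx
  have hq1 : (1 : ℝ) ≤ q := by exact_mod_cast Nat.one_le_iff_ne_zero.2 hq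
  set y : ℝ := (q : ℝ)⁻¹ with hy
  have hy0 : 0 < y := by positivity
  have hy1 : y ≤ 1 := inv_le_one_of_one_le₀ hq1
  have hqy : q * y = 1 := mul_inv_cancel₀ (by positivity)
  rcases lt_or_ge (1 + q * x) l with h | h
  · have h' := cast_choose_eq_prod hq x l
    rw [Nat.choose_eq_zero_of_lt h, Nat.cast_zero, eq_comm, mul_eq_zero] at h'
    rw [weightRatio, prod_div_distrib, h'.resolve_left (by positivity)]
    simp
  obtain ⟨l, rfl⟩ := Nat.exists_eq_add_of_le' hl
  rw [weightRatio, prod_range_succ', prod_range_succ', mul_assoc]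
  have hα := growthExponent_gt hy0.le
  refine mul_le_one₀ (prod_le_one (fun t ht => ?_) fun t ht => ?_) ?_ ?_
  · have ht' : (t : ℝ) + 2 ≤ 1 + q * x := by
      have := mem_range.1 ht
      exact_mod_cast (by omega : t + 2 ≤ 1 + q * x)
    refine div_nonneg ?_ (growthExponent_pos_of_one_le hy0.le hx' (Nat.cast_nonneg _)).le
    push_cast
    nlinarith
  · rw [div_le_one (growthExponent_pos_of_one_le hy0.le hx' (Nat.cast_nonneg _))]
    push_cast
    have : (0 : ℝ) ≤ t := t.cast_nonneg
    nlinarith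
  · refine mul_nonneg (div_nonneg ?_ ?_) (div_nonneg ?_ ?_) <;> norm_num <;> linarith
  · rw [div_mul_div_comm, div_le_one (mul_pos
      (growthExponent_pos_of_one_le hy0.le hx' (Nat.cast_nonneg _))
      (growthExponent_pos_of_one_le hy0.le hx' (Nat.cast_nonneg _)))]
    have hL := Real.log_two_gt_d9
    have hL' := Real.log_two_lt_d9
    push_cast
    have hA : 0 ≤ (1 + y) * (1 - Real.log 2) := mul_nonneg (by linarith) (by linarith)
    have key : 0 ≤ (1 + y) * (1 - Real.log 2) + growthExponent y * (1 + growthExponent y) := by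
      -- Replacing `α²` by its tangent at `-17/50`, close to the value of `α` at `y = 0`, leaves an
      -- inequality linear in `y`.
      have hsq : 0 ≤ (growthExponent y + 17 / 50) ^ 2 := sq_nonneg _
      have : (1 + y) * (1 - Real.log 2) + growthExponent y * (1 - 17 / 25) ≥ 17 / 50 * (17 / 50) := by
        rw [growthExponent]
        nlinarith
      nlinarith
    have hdiff : (x + (0 + 1 : ℝ) + growthExponent y) * (x + 0 + growthExponent y) -
        (x + (1 - (0 + 1)) * y) * (x + (1 - 0) * y) = (x - 1) * ((1 + y) * (1 - Real.log 2)) +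
        ((1 + y) * (1 - Real.log 2) + growthExponent y * (1 + growthExponent y)) := by
      rw [growthExponent]
      ring
    have := mul_nonneg (sub_nonneg.2 hx') hA
    linarith

theorem weightRatio_le (hq : q ≠ 0) {x : ℕ} (hx : 1 ≤ x) {l : ℕ} (hl : 1 ≤ l) :
    weightRatio (q : ℝ)⁻¹ x l ≤ 4 := by
  rcases hl.eq_or_lt with rfl | h
  · have hx' : (1 : ℝ) ≤ x := by exact_mod_cast hx
    have hq1 : (1 : ℝ) ≤ q := by exact_mod_cast Nat.one_le_iff_ne_zero.2 hq
    have hy0 : 0 ≤ (q : ℝ)⁻¹ := by positivity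
    have hy1 : (q : ℝ)⁻¹ ≤ 1 := inv_le_one_of_one_le₀ hq1
    have hα := growthExponent_gt hy0
    simp only [weightRatio, range_one, prod_singleton, Nat.cast_zero]
    rw [div_le_iff₀ (growthExponent_pos_of_one_le hy0 hx' le_rfl)]
    linarith
  · exact (weightRatio_le_one hq hx h).trans (by norm_num)

theorem abs_ite_weightRatio_sub_le (hq : q ≠ 0) {l : ℕ} (hl : 1 ≤ l) {m : ℕ} (hm : 1 ≤ m) :
    |(if l < m then weightRatio (q : ℝ)⁻¹ (m - l : ℕ) l else 0) - 1 -
      weightCoeff (q : ℝ)⁻¹ l / m| ≤ 400 * ((l : ℝ) ^ 2 / m) ^ 2 := by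
  have hq1 : (1 : ℝ) ≤ q := by exact_mod_cast Nat.one_le_iff_ne_zero.2 hq
  have hy0 : 0 ≤ (q : ℝ)⁻¹ := by positivity
  have hy1 : (q : ℝ)⁻¹ ≤ 1 := inv_le_one_of_one_le₀ hq1
  have hm0 : (0 : ℝ) < m := by exact_mod_cast hm
  -- For `m < 8 l²` no expansion is available, but then `r = l² / m ≥ 1/8` and the crude bound `5 +
  -- r` is below `400 r²`.
  rcases le_or_gt (8 * l ^ 2) m with h | h
  · have hlm : l < m := by nlinarith
    rw [if_pos hlm, Nat.cast_sub hlm.le]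
    refine (abs_weightRatio_sub_le hy0 hy1 hl (by exact_mod_cast h)).trans ?_
    nlinarith [sq_nonneg ((l : ℝ) ^ 2 / m)]
  · have hr : 1 / 8 ≤ (l : ℝ) ^ 2 / m := by
      rw [le_div_iff₀ hm0]
      have : (m : ℝ) < 8 * l ^ 2 := by exact_mod_cast h
      linarith
    set r := (l : ℝ) ^ 2 / m with hrdef
    have hR : |(if l < m then weightRatio (q : ℝ)⁻¹ (m - l : ℕ) l else 0) - 1| ≤ 5 := by
      split_ifs with hlm
      · have h1 := weightRatio_nonneg hq (x := m - l) (by omega) l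
        have h2 := weightRatio_le hq (x := m - l) (by omega) hl
        rw [abs_le]
        constructor <;> linarith
      · norm_num
    have hc : |weightCoeff (q : ℝ)⁻¹ l / m| ≤ r := by
      rw [abs_div, abs_of_pos hm0, hrdef]
      gcongr
      exact abs_weightCoeff_le hy0 hy1 l
    refine (abs_sub _ _).trans ((add_le_add hR hc).trans ?_)
    nlinarith

end Choose

/-! ### Moments of the limiting weights -/

section LimitWeight

theorem limitWeight_nonneg (l : ℕ) : 0 ≤ limitWeight l :=
  div_nonneg (pow_nonneg (Real.log_nonneg (by norm_num)) _) (Nat.cast_nonneg _)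

theorem succ_mul_limitWeight (l : ℕ) :
    ((l : ℝ) + 1) * limitWeight (l + 1) = Real.log 2 * limitWeight l := by
  rw [limitWeight, limitWeight, Nat.factorial_succ]
  push_cast
  field_simp
  ring

theorem hasSum_limitWeight : HasSum limitWeight 2 := by
  have h := NormedSpace.expSeries_div_hasSum_exp (Real.log 2)
  rwa [← congrFun Real.exp_eq_exp_ℝ, Real.exp_log (by norm_num)] at h

theorem hasSum_limitWeight_succ : HasSum (fun i => limitWeight (i + 1)) 1 := by
  rw [hasSum_nat_add_iff]
  simpa [limitWeight, one_add_one_eq_two] using hasSum_limitWeight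

theorem hasSum_succ_mul_limitWeight :
    HasSum (fun i : ℕ => ((i : ℝ) + 1) * limitWeight (i + 1)) (2 * Real.log 2) := by
  simp only [succ_mul_limitWeight]
  rw [mul_comm]
  exact hasSum_limitWeight.mul_left (Real.log 2)

theorem hasSum_mul_limitWeight_succ :
    HasSum (fun i : ℕ => (i : ℝ) * limitWeight (i + 1)) (2 * Real.log 2 - 1) := by
  refine (hasSum_succ_mul_limitWeight.sub hasSum_limitWeight_succ).congr_fun ?_
  intro i
  ring

theorem hasSum_succ_mul_mul_limitWeight :
    HasSum (fun i : ℕ => ((i : ℝ) + 1) * i * limitWeight (i + 1)) (2 * Real.log 2 ^ 2) := by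
  have h : HasSum (fun i : ℕ => (((i + 1 : ℕ) : ℝ) + 1) * ((i + 1 : ℕ) : ℝ) *
      limitWeight (i + 1 + 1)) (2 * Real.log 2 ^ 2) := by
    rw [mul_comm]
    refine (hasSum_limitWeight.mul_left (Real.log 2 ^ 2)).congr_fun fun i => ?_
    have h1 := succ_mul_limitWeight (i + 1)
    have h2 := succ_mul_limitWeight i
    push_cast at h1 ⊢
    linear_combination ((i : ℝ) + 1) * h1 + Real.log 2 * h2
  simpa using (hasSum_nat_add_iff (f := fun i : ℕ => ((i : ℝ) + 1) * i * limitWeight (i + 1)) 1).1 h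

/-- The sums of `l ln 2` and of `l (l - 1)` against the limit weights both equal `2 (ln 2)²`, so the
`1/m` term cancels. This is what dictates `growthExponent`. -/
theorem hasSum_limitWeight_mul_one_add (y m : ℝ) :
    HasSum (fun i => limitWeight (i + 1) * (1 + weightCoeff y (i + 1) / m)) 1 := by
  have h := hasSum_limitWeight_succ.add (((hasSum_succ_mul_limitWeight.mul_left (Real.log 2)).sub
    hasSum_succ_mul_mul_limitWeight).mul_left ((1 + y) / 2 / m))
  convert h using 1
  · funext i
    rw [weightCoeff]
    push_cast
    ring
  · ring

theorem summable_limitWeight_mul_pow :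
    Summable fun i : ℕ => limitWeight (i + 1) * ((i + 1 : ℕ) : ℝ) ^ 4 := by
  refine (summable_nat_add_iff (f := fun l : ℕ => limitWeight l * (l : ℝ) ^ 4) 1).2 ?_
  refine Summable.of_nonneg_of_le (fun l => mul_nonneg (limitWeight_nonneg l) (by positivity))
    (fun l => ?_) ((Real.summable_pow_div_factorial (Real.log 2 * Real.exp 1)).mul_left 24)
  have h := Real.pow_div_factorial_le_exp (l : ℝ) l.cast_nonneg 4
  rw [div_le_iff₀ (by positivity), ← Real.exp_one_pow] at h
  calc limitWeight l * (l : ℝ) ^ 4 ≤ limitWeight l * (Real.exp 1 ^ l * (Nat.factorial 4 : ℕ)) :=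
        mul_le_mul_of_nonneg_left h (limitWeight_nonneg l)
    _ = _ := by
      rw [limitWeight, mul_pow, show Nat.factorial 4 = 24 from rfl]
      push_cast
      ring

end LimitWeight

/-- The weight of `u (N - i)` in the recurrence for the normalised sequence. -/
noncomputable def weight (q N i : ℕ) : ℝ :=
  limitWeight (i + 1) *
    if i + 1 < N + 2 then weightRatio (q : ℝ)⁻¹ (N + 2 - (i + 1) : ℕ) (i + 1) else 0

section Weight

variable {q : ℕ}

theorem weight_nonneg (hq : q ≠ 0) (N i : ℕ) : 0 ≤ weight q N i := by
  refine mul_nonneg (limitWeight_nonneg _) ?_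
  split_ifs
  · exact weightRatio_nonneg hq (by omega) _
  · exact le_rfl

theorem weight_le (hq : q ≠ 0) {N i : ℕ} (hi : i ≠ 0) : weight q N i ≤ limitWeight (i + 1) := by
  refine mul_le_of_le_one_right (limitWeight_nonneg _) ?_
  split_ifs
  · exact weightRatio_le_one hq (by omega) (by omega)
  · exact zero_le_one

theorem abs_sum_weight_sub_one_le (hq : q ≠ 0) (N : ℕ) :
    |∑ i ∈ range (N + 1), weight q N i - 1| ≤
      (400 * ∑' i : ℕ, limitWeight (i + 1) * ((i + 1 : ℕ) : ℝ) ^ 4) * (1 / ((N + 2 : ℕ) : ℝ) ^ 2) := by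
  -- The weights vanish for `i > N`, so the finite sum is a full series, comparable termwise with
  -- one of sum exactly `1`.
  have h1 : HasSum (weight q N) (∑ i ∈ range (N + 1), weight q N i) := by
    refine hasSum_sum_of_ne_finset_zero fun i hi => ?_
    rw [weight, if_neg (by rw [mem_range] at hi; omega), mul_zero]
  have h2 := h1.sub (hasSum_limitWeight_mul_one_add (q : ℝ)⁻¹ ((N + 2 : ℕ) : ℝ))
  rw [← h2.tsum_eq, ← Real.norm_eq_abs]
  refine tsum_of_norm_bounded ((summable_limitWeight_mul_pow.hasSum.mul_left 400).mul_right
    (1 / ((N + 2 : ℕ) : ℝ) ^ 2)) fun i => ?_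
  rw [weight, ← mul_sub, Real.norm_eq_abs, abs_mul, abs_of_nonneg (limitWeight_nonneg _),
    ← sub_sub]
  refine (mul_le_mul_of_nonneg_left (abs_ite_weightRatio_sub_le hq (by omega) (by omega))
    (limitWeight_nonneg _)).trans_eq ?_
  ring

end Weight

/-! ### The normalised sequence and its limit -/

/-- The order of growth of `numIncreasingTrees (q + 1) (n + 1)`, up to a constant. -/
noncomputable def growthScale (q n : ℕ) : ℝ :=
  (q / Real.log 2) ^ (n + 1) * ∏ j ∈ range n, (j + 1 + growthExponent (q : ℝ)⁻¹)

section Normalised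

open KAryTree

variable {q : ℕ}

theorem growthScale_pos (hq : q ≠ 0) (n : ℕ) : 0 < growthScale q n := by
  have hL : 0 < Real.log 2 := Real.log_pos (by norm_num)
  have hα := growthExponent_gt (y := (q : ℝ)⁻¹) (by positivity)
  refine mul_pos (by positivity) (prod_pos fun j _ => ?_)
  have : (0 : ℝ) ≤ j := j.cast_nonneg
  linarith

theorem growthScale_add (q M i : ℕ) : growthScale q (M + (i + 1)) = growthScale q M *
    ((q / Real.log 2) ^ (i + 1) *
      ∏ t ∈ range (i + 1), (((M + 1 : ℕ) : ℝ) + t + growthExponent (q : ℝ)⁻¹)) := by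
  rw [growthScale, growthScale, prod_range_add]
  have : ∏ t ∈ range (i + 1), (((M + t : ℕ) : ℝ) + 1 + growthExponent (q : ℝ)⁻¹) =
      ∏ t ∈ range (i + 1), (((M + 1 : ℕ) : ℝ) + t + growthExponent (q : ℝ)⁻¹) :=
    prod_congr rfl fun t _ => by push_cast; ring
  rw [this]
  ring

theorem choose_div_growthScale (hq : q ≠ 0) (M i : ℕ) :
    ((1 + q * (M + 1)).choose (i + 1) : ℝ) / growthScale q (M + (i + 1)) =
      weight q (M + i) i / growthScale q M := by
  have hL : Real.log 2 ≠ 0 := (Real.log_pos (by norm_num)).ne'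
  have hq' : (q : ℝ) ≠ 0 := by exact_mod_cast hq
  have hM := (growthScale_pos hq M).ne'
  have hP : ∏ t ∈ range (i + 1), (((M + 1 : ℕ) : ℝ) + t + growthExponent (q : ℝ)⁻¹) ≠ 0 :=
    prod_ne_zero_iff.2 fun t _ => (growthExponent_pos_of_one_le (by positivity)
      (by simp) t.cast_nonneg).ne'
  rw [growthScale_add, cast_choose_eq_prod hq, weight, if_pos (by omega),
    show M + i + 2 - (i + 1) = M + 1 by omega, weightRatio, prod_div_distrib, limitWeight, div_pow]
  field_simp

theorem normalised_rec (hq : q ≠ 0) (N : ℕ) :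
    (numIncreasingTrees (q + 1) (N + 1 + 1) : ℝ) / growthScale q (N + 1) =
      ∑ i ∈ range (N + 1), weight q N i *
        ((numIncreasingTrees (q + 1) (N - i + 1) : ℝ) / growthScale q (N - i)) := by
  -- The term `j = 0` is `C(1, N + 2) = 0`, so the empty tree drops out and the normalised sequence
  -- can start at one node.
  rw [numIncreasingTrees_rec (by omega) (by omega), sum_range_succ', Nat.mul_zero,
    Nat.choose_eq_zero_of_lt (by omega), zero_mul, add_zero, ← sum_range_reflect, Nat.cast_sum,
    sum_div]
  refine sum_congr rfl fun i hi => ?_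
  obtain ⟨M, rfl⟩ : ∃ M, N = M + i := ⟨N - i, by have := mem_range.1 hi; omega⟩
  rw [show M + i + 1 - 1 - i = M by omega, show M + i - i = M by omega,
    show M + i + 1 + 1 - (M + 1) = i + 1 by omega, Nat.add_sub_cancel, Nat.cast_mul,
    mul_div_right_comm, add_assoc M i 1, choose_div_growthScale hq]
  ring

theorem numIncreasingTrees_pos (q m : ℕ) : 0 < numIncreasingTrees (q + 1) m := by
  induction m with
  | zero => simp [numIncreasingTrees_zero]
  | succ m ih =>
    rw [numIncreasingTrees_rec (by omega) (by omega), sum_range_succ]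
    exact Nat.add_pos_right _ (Nat.mul_pos (Nat.choose_pos (by omega)) ih)

theorem exists_tendsto_div_growthScale (hq : q ≠ 0) : ∃ L > 0, Tendsto
    (fun n => (numIncreasingTrees (q + 1) (n + 1) : ℝ) / growthScale q n) atTop (𝓝 L) := by
  refine exists_tendsto_of_averaging (v := weight q) (p := fun i => limitWeight (i + 1))
    (ρ := 2 * Real.log 2 - 1) (fun n => ?_) (normalised_rec hq) (weight_nonneg hq) ?_
    (abs_sum_weight_sub_one_le hq) (fun i => limitWeight_nonneg _)
    (fun N i _ hi => weight_le hq hi) (by linarith [Real.log_two_lt_d9]) fun n => ?_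
  · exact div_pos (by exact_mod_cast numIncreasingTrees_pos q _) (growthScale_pos hq n)
  · refine Summable.mul_left _ ?_
    exact (summable_nat_add_iff (f := fun n : ℕ => 1 / (n : ℝ) ^ 2) 2).2
      (Real.summable_one_div_nat_pow.2 one_lt_two)
  · exact sum_le_hasSum _ (fun i _ => mul_nonneg i.cast_nonneg (limitWeight_nonneg _))
      hasSum_mul_limitWeight_succ

end Normalised

/-- Euler's limit for `Γ(1 + α)`, inverted; the base `n + 1` instead of `n` matches `m = n + 1`
nodes. -/
theorem tendsto_prod_add_div_rpow_mul_factorial {α : ℝ} (hα : -1 < α) :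
    Tendsto (fun n : ℕ => (∏ j ∈ range n, ((j : ℝ) + 1 + α)) /
      (((n + 1 : ℕ) : ℝ) ^ α * n.factorial)) atTop (𝓝 (Real.Gamma (1 + α))⁻¹) := by
  have hΓ : Real.Gamma (1 + α) ≠ 0 := (Real.Gamma_pos_of_pos (by linarith)).ne'
  have hG := (Real.GammaSeq_tendsto_Gamma (1 + α)).inv₀ hΓ
  have h1 : Tendsto (fun n : ℕ => (n : ℝ) / ((n : ℝ) + 1)) atTop (𝓝 1) :=
    tendsto_natCast_div_add_atTop 1
  have h2 : Tendsto (fun n : ℕ => (n : ℝ) / ((n : ℝ) + (1 + α))) atTop (𝓝 1) :=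
    tendsto_natCast_div_add_atTop (1 + α)
  have h3 : Tendsto (fun n : ℕ => ((n : ℝ) / ((n : ℝ) + 1)) ^ α) atTop (𝓝 1) := by
    simpa using h1.rpow_const (p := α) (Or.inl one_ne_zero)
  have h := (hG.mul h2).mul h3
  rw [mul_one, mul_one] at h
  refine h.congr' ?_
  filter_upwards [eventually_ge_atTop 1] with n hn
  have hn' : (0 : ℝ) < n := by exact_mod_cast hn
  have hf : (n.factorial : ℝ) ≠ 0 := by exact_mod_cast n.factorial_ne_zero
  have hna : (n : ℝ) ^ α ≠ 0 := (Real.rpow_pos_of_pos hn' _).ne'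
  have hnb : ((n : ℝ) + 1) ^ α ≠ 0 := (Real.rpow_pos_of_pos (by linarith) _).ne'
  have hn1 : (n : ℝ) + (1 + α) ≠ 0 := by linarith
  have hp : ∏ j ∈ range n, (1 + α + (j : ℝ)) = ∏ j ∈ range n, ((j : ℝ) + 1 + α) :=
    prod_congr rfl fun j _ => by ring
  rw [Real.GammaSeq, prod_range_succ, hp, Real.div_rpow hn'.le (by linarith), Real.rpow_add hn',
    Real.rpow_one, add_comm (1 + α) (n : ℝ)]
  push_cast
  field_simp

end Asymptotics

theorem mainTheorem2 (k : ℕ) (hk : 2 ≤ k) :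
    (∀ n : ℕ, (weaklyIncreasingTrees k n).Finite) ∧
    (∀ n : ℕ, ¬ n ≡ 1 [MOD (k - 1)] → numWeaklyIncreasingTrees k n = 0) ∧
    ∃ η : ℝ, 0 < η ∧
      Asymptotics.IsEquivalent Filter.atTop
        (fun m : ℕ => (numWeaklyIncreasingTrees k (1 + (k - 1) * m) : ℝ))
        (fun m : ℕ => η * (m : ℝ) ^ ((2 - (k : ℝ) * Real.log 2) / (2 * ((k : ℝ) - 1))) *
          (((k : ℝ) - 1) / Real.log 2) ^ m * (Nat.factorial (m - 1) : ℝ)) := by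
  refine ⟨KAryTree.finite_weaklyIncreasingTrees hk,
    fun n hn => KAryTree.numWeaklyIncreasingTrees_eq_zero hk hn, ?_⟩
  obtain ⟨q, rfl⟩ : ∃ q, k = q + 1 := ⟨k - 1, by omega⟩
  have hq : q ≠ 0 := by omega
  have hq' : (q : ℝ) ≠ 0 := by exact_mod_cast hq
  have hL : 0 < Real.log 2 := Real.log_pos (by norm_num)
  obtain ⟨L, hL0, hLim⟩ := exists_tendsto_div_growthScale hq
  set α := growthExponent (q : ℝ)⁻¹ with hα
  have hα' : (2 - ((q + 1 : ℕ) : ℝ) * Real.log 2) / (2 * (((q + 1 : ℕ) : ℝ) - 1)) = α := by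
    rw [hα, growthExponent]
    push_cast
    rw [add_sub_cancel_right, div_eq_iff (by positivity)]
    linear_combination (Real.log 2 - 2) * mul_inv_cancel₀ hq'
  have hα1 : -1 < α := by
    have := growthExponent_gt (y := (q : ℝ)⁻¹) (by positivity)
    linarith
  have hΓ : 0 < Real.Gamma (1 + α) := Real.Gamma_pos_of_pos (by linarith)
  set η := L * (Real.Gamma (1 + α))⁻¹ with hη
  have hη0 : 0 < η := by positivity
  refine ⟨η, hη0, Asymptotics.isEquivalent_of_tendsto_one ?_⟩
  rw [← Filter.tendsto_add_atTop_iff_nat 1]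
  have h := (hLim.mul (tendsto_prod_add_div_rpow_mul_factorial hα1)).div_const η
  rw [← hη, div_self hη0.ne'] at h
  refine h.congr fun n => ?_
  have hs := (growthScale_pos hq n).ne'
  rw [growthScale, ← hα] at hs ⊢
  rw [Pi.div_apply, hα', numWeaklyIncreasingTrees, KAryTree.weaklyIncreasingTrees_eq hk (by omega),
    Nat.add_sub_cancel, show (((q + 1 : ℕ) : ℝ) - 1) = q by push_cast; ring]
  change (KAryTree.numIncreasingTrees _ _ : ℝ) / _ * _ / _ = (KAryTree.numIncreasingTrees _ _ : ℝ) / _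
  have hP := right_ne_zero_of_mul hs
  have hf : (n.factorial : ℝ) ≠ 0 := by exact_mod_cast n.factorial_ne_zero
  have hn : ((n + 1 : ℕ) : ℝ) ^ α ≠ 0 := (Real.rpow_pos_of_pos (by positivity) _).ne'
  field_simp
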